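/- Conventions. A subgroup of $\mathsf{GL}_d(\mathbb{C})$ is *strongly irreducible* if each of its finite-index subgroups acts irreducibly on $\mathbb{C}^d$. A matrix $g\in\mathsf{GL}_d(\mathbb{C})$ is *proximal* if it has a unique eigenvalue of maximal absolute value, counted with algebraic multiplicity. A subgroup $N$ of a group $G$ is *coabelian* if $N$ is normal in $G$ and $G/N$ is abelian. A representation of $H\le G$ *extends* to $G$ if it is the restriction to $H$ of a homomorphism from $G$ into the same general linear group. **Lemma.** Let $d\ge 2$, let $\Delta<\mathsf{GL}_d(\mathbb{C})$ be a strongly irreducible, finitely generated subgroup all of whose infinite-order elements are proximal, and let $K\trianglelefteq\Delta$ be an infinite, finitely generated normal subgroup such that $\Delta/K$ is abelian. Then there exist finite-index subgroups $\Gamma\trianglelefteq\Delta$ and $K'\trianglelefteq K$ such that $K'$ is contained and coabelian in $\Gamma$, and a finite-index subgroup $L$ of the fibre product $\{(g_1,g_2)\in\Gamma\times\Gamma : g_1^{-1}g_2\in K'\}$, such that the following hold. (i) There is an irreducible representation $\rho:L\to\mathsf{GL}_{r}(\mathbb{C})$, $r=d^2$, which does not extend to a representation of $\Gamma\times\Gamma$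 into $\mathsf{GL}_r(\mathbb{C})$. (ii) Let $m,q$ be non-negative integers, let $\Delta'<\mathsf{GL}_m(\mathbb{C})$ be a strongly irreducible, finitely generated subgroup all of whose infinite-order elements are proximal, and let $M$ be a subgroup of the direct product $(\Delta')^q=\Delta'\times\cdots\times\Delta'$ of $q$ copies of $\Delta'$ that contains $N^q=N\times\cdots\times N$ for some infinite normal subgroup $N\trianglelefteq\Delta'$. Then there is an irreducible representation $\psi:L\times M\to\mathsf{GL}_s(\mathbb{C})$, $s=d^2m^q$, which does not extend to a representation of $\Gamma\times\Gamma\times(\Delta')^q$ into $\mathsf{GL}_s(\mathbb{C})$. -/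

import Mathlib

namespace NonExtension

/-- The linear representation on `ℂⁿ` (column vectors) given by a homomorphism into `GL_n(ℂ)`. -/
noncomputable def toRep {G : Type*} [Group G] {n : ℕ} (ρ : G →* GL (Fin n) ℂ) :
    Representation ℂ G (Fin n → ℂ) :=
  (Units.coeHom ((Fin n → ℂ) →ₗ[ℂ] (Fin n → ℂ))).comp
    ((Matrix.GeneralLinearGroup.toLin (n := Fin n) (R := ℂ)).toMonoidHom.comp ρ)

/-- `ρ : G → GL_n(ℂ)` is irreducible: `ℂⁿ` is nonzero and has no proper nonzero
`G`-invariant subspace. -/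
def IsIrreducibleRep {G : Type*} [Group G] {n : ℕ} (ρ : G →* GL (Fin n) ℂ) : Prop :=
  (toRep ρ).IsIrreducible

theorem toRep_apply {G : Type*} [Group G] {n : ℕ} (ρ : G →* GL (Fin n) ℂ) (g : G)
    (v : Fin n → ℂ) : toRep ρ g v = (ρ g : Matrix (Fin n) (Fin n) ℂ).mulVec v := rfl

/-- `Δ < GL_n(ℂ)` is strongly irreducible: every finite-index subgroup of `Δ` acts irreducibly
on `ℂⁿ`. -/
def IsStronglyIrreducible {n : ℕ} (Δ : Subgroup (GL (Fin n) ℂ)) : Prop :=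
  ∀ H : Subgroup Δ, H.FiniteIndex → IsIrreducibleRep (Δ.subtype.comp H.subtype)

/-- `g ∈ GL_n(ℂ)` is proximal: it has a unique eigenvalue of maximal absolute value, counted with
(algebraic) multiplicity. -/
def IsProximal {n : ℕ} (g : GL (Fin n) ℂ) : Prop :=
  ∃ z : ℂ, (g : Matrix (Fin n) (Fin n) ℂ).charpoly.rootMultiplicity z = 1 ∧
    ∀ w : ℂ, (g : Matrix (Fin n) (Fin n) ℂ).charpoly.IsRoot w → w ≠ z → ‖w‖ < ‖z‖

/-- `N` is a normal subgroup of `G` with abelian quotient `G / N`. -/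
def IsCoabelian {G : Type*} [Group G] (N : Subgroup G) : Prop :=
  ∃ _ : N.Normal, ∀ x y : G ⧸ N, x * y = y * x

/-- The fibre product `{(g₁, g₂) ∈ G × G : g₁⁻¹ g₂ ∈ N}` of a normal subgroup `N` of `G`. -/
def fibreProduct {G : Type*} [Group G] (N : Subgroup G) (hN : N.Normal) : Subgroup (G × G) where
  carrier := {p | p.1⁻¹ * p.2 ∈ N}
  one_mem' := by simp
  mul_mem' := by
    intro a b ha hb
    simp only [Set.mem_setOf_eq, Prod.fst_mul, Prod.snd_mul] at *
    have h := N.mul_mem (hN.conj_mem _ ha b.1⁻¹) hb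
    have e : (a.1 * b.1)⁻¹ * (a.2 * b.2)
        = b.1⁻¹ * (a.1⁻¹ * a.2) * b.1⁻¹⁻¹ * (b.1⁻¹ * b.2) := by group
    rw [e]
    exact h
  inv_mem' := by
    intro a ha
    simp only [Set.mem_setOf_eq, Prod.fst_inv, Prod.snd_inv] at *
    have h := hN.conj_mem _ (N.inv_mem ha) a.1
    have e : a.1⁻¹⁻¹ * a.2⁻¹ = a.1 * (a.1⁻¹ * a.2)⁻¹ * a.1⁻¹ := by group
    rw [e]
    exact h

/-- The representation `ρ : H → GL_n(ℂ)` extends along `ι : H → G` to a representation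
`G → GL_n(ℂ)`. -/
def Extends {H G : Type*} [Group H] [Group G] {n : ℕ} (ι : H →* G) (ρ : H →* GL (Fin n) ℂ) :
    Prop :=
  ∃ σ : G →* GL (Fin n) ℂ, ∀ h : H, σ (ι h) = ρ h

end NonExtension

/-! The obstruction is a character. Some finite-index normal Γ in Δ is residually a finite p-group
and non-abelian, so it has a finite p-quotient, and then a quotient of class exactly two, in which
some commutator survives. A central character that is nontrivial on this commutator pulls back to a
conjugation-invariant character φ of a finite-index subgroup Z of Γ. Let K' be the intersection of K
with the normal core of Z in Δ; it contains every commutator of Γ. Invariance of φ makes χ(g₁, g₂) =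
φ(g₁⁻¹g₂) a homomorphism on the fibre product. It cannot extend to Γ × Γ, where (1, [x, y]) is a
commutator but χ(1, [x, y]) ≠ 1.

The representation in (i) is χ ⊗ T, with T the external tensor square of the inclusion. An infinite
normal subgroup has an element of infinite order (`exists_not_isOfFinOrder`), which is proximal, and
is therefore irreducible (`isIrreducibleRep_of_normal_of_isProximal`). By Burnside's theorem its
matrices span, so T spans on K' × K'. If σ extended χ ⊗ T, Schur's lemma would give σ = cT for a
character c of Γ × Γ extending χ (`exists_extension_of_extends_twist`). For (ii), T is tensored
further with the q-th tensor power for Δ', which spans on N^q. -/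

namespace NonExtension

open Matrix
open scoped commutatorElement IsMulCommutative

/-! ### Burnside's theorem and external tensor products -/

/-- The matrices `ρ g` span the whole matrix algebra. -/
def Spans {G : Type*} [Group G] {n : ℕ} (ρ : G →* GL (Fin n) ℂ) : Prop :=
  Submodule.span ℂ (Set.range fun g => (ρ g : Matrix (Fin n) (Fin n) ℂ)) = ⊤

theorem isIrreducibleRep_iff {G : Type*} [Group G] {n : ℕ} (ρ : G →* GL (Fin n) ℂ) :
    IsIrreducibleRep ρ ↔ n ≠ 0 ∧ ∀ U : Submodule ℂ (Fin n → ℂ),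
      (∀ g, ∀ v ∈ U, (ρ g : Matrix (Fin n) (Fin n) ℂ) *ᵥ v ∈ U) → U = ⊥ ∨ U = ⊤ := by
  constructor
  · intro h
    have h' : IsSimpleOrder (Subrepresentation (toRep ρ)) := h
    refine ⟨?_, fun U hU => ?_⟩
    · rintro rfl
      obtain ⟨x, y, hxy⟩ := h'.exists_pair_ne
      exact hxy (Subrepresentation.toSubmodule_injective (Subsingleton.elim _ _))
    · let S : Subrepresentation (toRep ρ) := ⟨U, fun g v hv => hU g v hv⟩
      exact (h'.eq_bot_or_eq_top S).imp (congrArg Subrepresentation.toSubmodule)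
        (congrArg Subrepresentation.toSubmodule)
  · rintro ⟨hn, h⟩
    have hne : Nonempty (Fin n) := ⟨⟨0, Nat.pos_of_ne_zero hn⟩⟩
    refine { exists_pair_ne := ⟨⊥, ⊤, fun e => ?_⟩, eq_bot_or_eq_top := fun S => ?_ }
    · exact bot_ne_top (congrArg Subrepresentation.toSubmodule e)
    · exact (h S.toSubmodule fun g v hv => S.apply_mem_toSubmodule g hv).imp
        (fun e => Subrepresentation.toSubmodule_injective e)
        (fun e => Subrepresentation.toSubmodule_injective e)

theorem Spans.isIrreducibleRep {G : Type*} [Group G] {n : ℕ} {ρ : G →* GL (Fin n) ℂ}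
    (h : Spans ρ) (hn : n ≠ 0) : IsIrreducibleRep ρ := by
  refine (isIrreducibleRep_iff ρ).2 ⟨hn, fun U hU => ?_⟩
  have key : ∀ A : Matrix (Fin n) (Fin n) ℂ, ∀ v ∈ U, A *ᵥ v ∈ U := by
    intro A v hv
    have hA : A ∈ Submodule.span ℂ (Set.range fun g => (ρ g : Matrix (Fin n) (Fin n) ℂ)) := by
      rw [h]; trivial
    induction hA using Submodule.span_induction with
    | mem x hx => obtain ⟨g, rfl⟩ := hx; exact hU g v hv
    | zero => simp
    | add x y _ _ hx hy => rw [Matrix.add_mulVec]; exact U.add_mem hx hy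
    | smul a x _ hx => rw [Matrix.smul_mulVec]; exact U.smul_mem a hx
  refine or_iff_not_imp_left.2 fun hU0 => ?_
  obtain ⟨v, hv, hv0⟩ := U.ne_bot_iff.1 hU0
  obtain ⟨i, hi⟩ := Function.ne_iff.1 hv0
  rw [eq_top_iff]
  intro w _
  -- This rank-one matrix sends `v` to `w`.
  have := key (Matrix.vecMulVec w (Pi.single i (v i)⁻¹)) v hv
  rwa [Matrix.vecMulVec_mulVec, single_dotProduct, inv_mul_cancel₀ hi, MulOpposite.op_one,
    one_smul] at this

/-- Burnside's theorem: by Schur the commutant is ℂ, so every matrix commutes with it. The density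
theorem, applied to the standard basis, then realises the matrix by an element of the group algebra.
-/
theorem IsIrreducibleRep.spans {G : Type*} [Group G] {n : ℕ} {ρ : G →* GL (Fin n) ℂ}
    (h : IsIrreducibleRep ρ) : Spans ρ := by
  have hs : IsSimpleModule (MonoidAlgebra ℂ G) (toRep ρ).asModule :=
    (Representation.irreducible_iff_isSimpleModule_asModule _).1 h
  have : FiniteDimensional ℂ (toRep ρ).asModule :=
    inferInstanceAs (FiniteDimensional ℂ (Fin n → ℂ))
  classical
  have hbij := IsSimpleModule.algebraMap_end_bijective_of_isAlgClosed ℂ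
    (A := MonoidAlgebra ℂ G) (V := (toRep ρ).asModule)
  refine eq_top_iff.2 fun X _ => ?_
  let f : Module.End (Module.End (MonoidAlgebra ℂ G) (toRep ρ).asModule) (toRep ρ).asModule :=
    { toFun := fun v => X *ᵥ v
      map_add' := fun v w => Matrix.mulVec_add X v w
      map_smul' := fun c v => by
        obtain ⟨a, rfl⟩ := hbij.2 c
        exact Matrix.mulVec_smul X a v }
  obtain ⟨r, hr⟩ := jacobson_density f
    (Finset.univ.image fun i : Fin n => (Pi.single i (1 : ℂ) : Fin n → ℂ))
  have hX : X = LinearMap.toMatrix' ((toRep ρ).asAlgebraHom r) := by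
    ext i j
    have := hr (Pi.single j 1 : Fin n → ℂ) (Finset.mem_image_of_mem _ (Finset.mem_univ j))
    rw [LinearMap.toMatrix'_apply]
    exact (congrFun (Matrix.mulVec_single_one X j) i).symm.trans (congrFun this i)
  rw [hX]
  clear hX hr
  induction r using MonoidAlgebra.induction_on with
  | of g =>
    refine Submodule.subset_span ⟨g, ?_⟩
    rw [Representation.asAlgebraHom_of]
    exact (LinearMap.toMatrix'_toLin' _).symm
  | add a b ha hb => rw [map_add, map_add]; exact Submodule.add_mem _ ha hb
  | smul c a ha => rw [map_smul, map_smul]; exact Submodule.smul_mem _ c ha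

/-- The external tensor product of two groups of invertible matrices. -/
noncomputable def kron (a b : ℕ) :
    GL (Fin a) ℂ × GL (Fin b) ℂ →* GL (Fin (a * b)) ℂ :=
  (Units.map
    { toFun := fun p : Matrix (Fin a) (Fin a) ℂ × Matrix (Fin b) (Fin b) ℂ =>
        Matrix.reindexAlgEquiv ℂ ℂ finProdFinEquiv (Matrix.kronecker p.1 p.2)
      map_one' := by simp
      map_mul' := fun p q => by
        rw [← map_mul]
        exact congrArg _ (Matrix.mul_kronecker_mul p.1 q.1 p.2 q.2) }).comp
    (MulEquiv.prodUnits.symm.toMonoidHom)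

/-- Elementary matrices of the product are Kronecker products of elementary matrices, and
bilinearity passes from generators to spans. -/
theorem Spans.kron {G H : Type*} [Group G] [Group H] {a b : ℕ} {ρ : G →* GL (Fin a) ℂ}
    {τ : H →* GL (Fin b) ℂ} (hρ : Spans ρ) (hτ : Spans τ) :
    Spans ((NonExtension.kron a b).comp (ρ.prodMap τ)) := by
  let e := (Matrix.reindexAlgEquiv ℂ ℂ (finProdFinEquiv (m := a) (n := b))).toLinearEquiv
  let B : Matrix (Fin a) (Fin a) ℂ →ₗ[ℂ] Matrix (Fin b) (Fin b) ℂ →ₗ[ℂ]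
    Matrix (Fin a × Fin b) (Fin a × Fin b) ℂ := Matrix.kroneckerBilinear
  have h1 : (Set.range fun g => (((NonExtension.kron a b).comp (ρ.prodMap τ)) g : Matrix _ _ ℂ)) =
      e '' Set.image2 (fun x y => B x y)
        (Set.range fun g => (ρ g : Matrix (Fin a) (Fin a) ℂ))
        (Set.range fun h => (τ h : Matrix (Fin b) (Fin b) ℂ)) := by
    ext x
    constructor
    · rintro ⟨⟨g, h⟩, rfl⟩
      exact ⟨_, ⟨_, ⟨g, rfl⟩, _, ⟨h, rfl⟩, rfl⟩, rfl⟩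
    · rintro ⟨_, ⟨_, ⟨g, rfl⟩, _, ⟨h, rfl⟩, rfl⟩, rfl⟩
      exact ⟨(g, h), rfl⟩
  unfold Spans
  have h2 : Submodule.span ℂ (e '' Set.image2 (fun x y => B x y)
        (Set.range fun g => (ρ g : Matrix (Fin a) (Fin a) ℂ))
        (Set.range fun h => (τ h : Matrix (Fin b) (Fin b) ℂ))) =
      (Submodule.map₂ B ⊤ ⊤).map e.toLinearMap := by
    rw [← hρ, ← hτ, Submodule.map₂_span_span, Submodule.map_span]
    rfl
  rw [h1, h2]
  have h3 : Submodule.map₂ B ⊤ ⊤ = ⊤ := by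
    refine eq_top_iff.2 fun X _ => ?_
    rw [Matrix.matrix_eq_sum_single X]
    refine Submodule.sum_mem _ fun i _ => Submodule.sum_mem _ fun j _ => ?_
    have := Matrix.single_kronecker_single i.1 j.1 i.2 j.2 (X i j) (1 : ℂ)
    rw [mul_one] at this
    rw [← this]
    exact Submodule.apply_mem_map₂ B (Submodule.mem_top)
      (Submodule.mem_top)
  rw [h3, Submodule.map_top, LinearEquiv.range]

theorem Spans.comp {G H : Type*} [Group G] [Group H] {n : ℕ} {ρ : G →* GL (Fin n) ℂ}
    (hρ : Spans ρ) {f : H →* G} (hf : Function.Surjective f) : Spans (ρ.comp f) := by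
  unfold Spans at *
  rw [← hρ, ← hf.range_comp]
  rfl

theorem Spans.of_comp {G H : Type*} [Group G] [Group H] {n : ℕ} {ρ : G →* GL (Fin n) ℂ}
    {f : H →* G} (h : Spans (ρ.comp f)) : Spans ρ := by
  refine eq_top_iff.2 (h.symm.le.trans (Submodule.span_mono ?_))
  rintro _ ⟨x, rfl⟩
  exact ⟨f x, rfl⟩

/-- The `q`-fold external tensor power of a representation. -/
noncomputable def tensorPow {G : Type*} [Group G] {m : ℕ} (ρ : G →* GL (Fin m) ℂ) :
    (q : ℕ) → ((Fin q → G) →* GL (Fin (m ^ q)) ℂ)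
  | 0 => 1
  | q + 1 => (kron (m ^ q) m).comp (((tensorPow ρ q).prodMap ρ).comp
      ((MonoidHom.pi fun i => Pi.evalMonoidHom _ i.castSucc).prod
        (Pi.evalMonoidHom _ (Fin.last q))))

theorem tensorPow_comp {G H : Type*} [Group G] [Group H] {m : ℕ} (ρ : G →* GL (Fin m) ℂ)
    (f : H →* G) (q : ℕ) (h : Fin q → H) :
    tensorPow (ρ.comp f) q h = tensorPow ρ q fun i => f (h i) := by
  induction q with
  | zero => rfl
  | succ q ih =>
    change kron (m ^ q) m (tensorPow (ρ.comp f) q fun i => h i.castSucc, _) = _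
    rw [ih]
    rfl

theorem Spans.tensorPow {G : Type*} [Group G] {m : ℕ} {ρ : G →* GL (Fin m) ℂ} (hρ : Spans ρ)
    (q : ℕ) : Spans (tensorPow ρ q) := by
  induction q with
  | zero =>
    refine eq_top_iff.2 fun X _ => ?_
    have : X = X 0 0 • (1 : Matrix (Fin 1) (Fin 1) ℂ) := by
      ext i j
      fin_cases i; fin_cases j; simp; rfl
    rw [this]
    exact Submodule.smul_mem _ _ (Submodule.subset_span ⟨1, rfl⟩)
  | succ q ih =>
    refine (ih.kron hρ).comp (f := MonoidHom.prod _ _) fun p => ⟨Fin.snoc p.1 p.2, ?_⟩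
    refine Prod.ext (funext fun i => ?_) ?_
    · exact Fin.snoc_castSucc (α := fun _ => G) _ _ _
    · exact Fin.snoc_last (α := fun _ => G) _ _

/-! ### Schur's lemma and twists by characters -/

theorem Spans.eq_scalar_of_commute {G : Type*} [Group G] {n : ℕ} {ρ : G →* GL (Fin n) ℂ}
    (hρ : Spans ρ) {X : Matrix (Fin n) (Fin n) ℂ}
    (hX : ∀ g, (ρ g : Matrix (Fin n) (Fin n) ℂ) * X = X * (ρ g : Matrix (Fin n) (Fin n) ℂ)) :
    ∃ c : ℂ, X = c • 1 := by
  have key : ∀ Y : Matrix (Fin n) (Fin n) ℂ, Y * X = X * Y := by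
    intro Y
    have hY : Y ∈ Submodule.span ℂ (Set.range fun g => (ρ g : Matrix (Fin n) (Fin n) ℂ)) := by
      rw [hρ]; trivial
    induction hY using Submodule.span_induction with
    | mem x hx => obtain ⟨g, rfl⟩ := hx; exact hX g
    | zero => simp
    | add x y _ _ hx hy => rw [add_mul, mul_add, hx, hy]
    | smul a x _ hx => rw [smul_mul_assoc, mul_smul_comm, hx]
  obtain ⟨c, hc⟩ := Matrix.mem_range_scalar_iff_commute_single'.2 fun i j => key _
  refine ⟨c, ?_⟩
  rw [← hc, Matrix.smul_one_eq_diagonal]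
  rfl

/-- The twist of a representation by a character. -/
def twist {H : Type*} [Group H] {n : ℕ} (χ : H →* ℂˣ) (τ : H →* GL (Fin n) ℂ) :
    H →* GL (Fin n) ℂ :=
  MonoidHom.mk' (fun h => Matrix.GeneralLinearGroup.scalar (Fin n) (χ h) * τ h) fun a b => by
    rw [map_mul, map_mul, map_mul, mul_assoc, mul_assoc, ← mul_assoc (τ a),
      ← Matrix.GeneralLinearGroup.scalar_commute, mul_assoc]

theorem coe_twist {H : Type*} [Group H] {n : ℕ} (χ : H →* ℂˣ) (τ : H →* GL (Fin n) ℂ) (h : H) :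
    (twist χ τ h : Matrix (Fin n) (Fin n) ℂ) =
      (χ h : ℂ) • (τ h : Matrix (Fin n) (Fin n) ℂ) := by
  change Matrix.scalar (Fin n) (χ h : ℂ) * (τ h : Matrix (Fin n) (Fin n) ℂ) = _
  rw [Matrix.scalar_apply, ← Matrix.smul_eq_diagonal_mul]

theorem Spans.twist {H : Type*} [Group H] {n : ℕ} {τ : H →* GL (Fin n) ℂ} (hτ : Spans τ)
    (χ : H →* ℂˣ) : Spans (twist χ τ) := by
  refine eq_top_iff.2 (hτ.symm.le.trans (Submodule.span_le.2 ?_))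
  rintro _ ⟨h, rfl⟩
  have : (τ h : Matrix (Fin n) (Fin n) ℂ) =
      ((χ h)⁻¹ : ℂˣ).val • (NonExtension.twist χ τ h : Matrix (Fin n) (Fin n) ℂ) := by
    rw [coe_twist, smul_smul, Units.inv_mul, one_smul]
  change (τ h : Matrix (Fin n) (Fin n) ℂ) ∈ _
  rw [this]
  exact Submodule.smul_mem _ _ (Submodule.subset_span ⟨h, rfl⟩)

/-- If `T` is spanning on a subgroup `J` of `H` on which `χ` is invariant under
conjugation by `G`, then an extension of `χ ⊗ T` to `G` yields an extension of `χ` to `G`. -/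
theorem exists_extension_of_extends_twist {G H J : Type*} [Group G] [Group H] [Group J] {n : ℕ}
    (hn : n ≠ 0) (ι : H →* G) (j : J →* H) (T : G →* GL (Fin n) ℂ) (χ : H →* ℂˣ)
    (hT : Spans (T.comp (ι.comp j)))
    (hχ : ∀ (g : G) (x : J), ∃ y : J, ι (j y) = g * ι (j x) * g⁻¹ ∧ χ (j y) = χ (j x))
    (hext : Extends ι (twist χ (T.comp ι))) : ∃ c : G →* ℂˣ, ∀ h, c (ι h) = χ h := by
  obtain ⟨σ, hσ⟩ := hext
  have hne : Nonempty (Fin n) := ⟨⟨0, Nat.pos_of_ne_zero hn⟩⟩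
  have hs : ∀ h, σ (ι h) = Matrix.GeneralLinearGroup.scalar (Fin n) (χ h) * T (ι h) := hσ
  -- `T g` and `σ g` conjugate each `T (ι (j x))` to the same matrix, the values of `χ` cancelling
  -- by invariance. So `(T g)⁻¹ * σ g` commutes with a spanning set.
  have key : ∀ g : G, ∃ c : ℂ, ((T g)⁻¹ * σ g : GL (Fin n) ℂ).val = c • 1 := by
    intro g
    refine hT.eq_scalar_of_commute fun x => ?_
    obtain ⟨y, hy, hy'⟩ := hχ g x
    have e1 : σ (ι (j y)) = σ g * σ (ι (j x)) * (σ g)⁻¹ := by rw [hy]; simp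
    have e2 : T (ι (j y)) = T g * T (ι (j x)) * (T g)⁻¹ := by rw [hy]; simp
    rw [hs, hs, hy', e2] at e1
    have hc := fun A => Matrix.GeneralLinearGroup.scalar_commute (n := Fin n) (χ (j x)) A
    have e3 : T g * T (ι (j x)) * (T g)⁻¹ = σ g * T (ι (j x)) * (σ g)⁻¹ := by
      rw [← mul_assoc (σ g), ← hc (σ g)] at e1
      simp only [mul_assoc] at e1 ⊢
      exact mul_left_cancel e1
    have e4 : T (ι (j x)) * ((T g)⁻¹ * σ g) = (T g)⁻¹ * σ g * T (ι (j x)) := by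
      have := congrArg (fun z => (T g)⁻¹ * z * σ g) e3
      simpa [mul_assoc] using this
    exact congrArg Units.val e4
  choose c hc using key
  have hinj : Function.Injective fun a : ℂ => a • (1 : Matrix (Fin n) (Fin n) ℂ) := by
    intro a b h
    have := congrFun (congrFun h hne.some) hne.some
    simpa using this
  have hval : ∀ g, (σ g).val = c g • (T g).val := by
    intro g
    have := congrArg (fun z => (T g).val * z) (hc g)
    simp only [← Units.val_mul, mul_inv_cancel_left] at this
    rw [this, mul_smul_comm, mul_one]
  have hmul : ∀ g h, c (g * h) = c g * c h := by
    intro g h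
    apply hinj
    change c (g * h) • (1 : Matrix (Fin n) (Fin n) ℂ) = (c g * c h) • 1
    rw [← hc, map_mul, map_mul, _root_.mul_inv_rev, Units.val_mul, Units.val_mul, Units.val_mul, hval,
      hval, mul_smul_comm, smul_mul_assoc, mul_smul_comm, mul_smul_comm, smul_smul, mul_assoc,
      ← mul_assoc (T g)⁻¹.val, Units.inv_mul, one_mul, Units.inv_mul, mul_comm]
  have hone : c 1 = 1 := hinj (by
    change c 1 • (1 : Matrix (Fin n) (Fin n) ℂ) = (1 : ℂ) • 1
    rw [← hc]; simp)
  let C : G →* ℂ := ⟨⟨c, hone⟩, hmul⟩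
  refine ⟨C.toHomUnits, fun h => Units.ext (hinj ?_)⟩
  change c (ι h) • (1 : Matrix (Fin n) (Fin n) ℂ) = (χ h : ℂ) • 1
  rw [← hc, hs]
  have : (T (ι h))⁻¹ * (Matrix.GeneralLinearGroup.scalar (Fin n) (χ h) * T (ι h)) =
      Matrix.GeneralLinearGroup.scalar (Fin n) (χ h) := by
    rw [Matrix.GeneralLinearGroup.scalar_commute, inv_mul_cancel_left]
  rw [this, Matrix.smul_one_eq_diagonal]
  rfl

/-! ### Normal subgroups containing a proximal element -/

/-- A simple root `z` of the characteristic polynomial of `g` gives a polynomial in `g` of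
rank one, equal to `x ↦ f x • v` with `f v ≠ 0`. -/
theorem exists_aeval_eq_rank_one {V : Type*} [AddCommGroup V] [Module ℂ V]
    [FiniteDimensional ℂ V] (g : Module.End ℂ V) (z : ℂ)
    (hz : g.charpoly.rootMultiplicity z = 1) :
    ∃ (q : Polynomial ℂ) (f : Module.Dual ℂ V) (v : V),
      (∀ x, Polynomial.aeval g q x = f x • v) ∧ f v ≠ 0 := by
  have h0 : g.charpoly ≠ 0 := g.charpoly_monic.ne_zero
  obtain ⟨q, hq, hnd⟩ := Polynomial.exists_eq_pow_rootMultiplicity_mul_and_not_dvd _ h0 z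
  rw [hz, pow_one] at hq
  rw [Polynomial.dvd_iff_isRoot] at hnd
  have hroot : g.charpoly.IsRoot z := by
    rw [← Polynomial.rootMultiplicity_pos h0, hz]; exact one_pos
  obtain ⟨v, hv⟩ := (Module.End.hasEigenvalue_iff_isRoot_charpoly g z |>.2
    hroot).exists_hasEigenvector
  have hev : Polynomial.aeval g q v = q.eval z • v := Module.End.aeval_apply_of_hasEigenvector hv
  have hrange : ∀ x, ∃ c : ℂ, Polynomial.aeval g q x = c • v := by
    intro x
    -- Cayley–Hamilton for charpoly = (X - z) q; the eigenspace is a line because the algebraic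
    -- multiplicity is one.
    have hx : Polynomial.aeval g q x ∈ g.eigenspace z := by
      rw [Module.End.mem_eigenspace_iff, ← sub_eq_zero]
      have := LinearMap.congr_fun g.aeval_self_charpoly x
      rw [hq, map_mul] at this
      simpa [Module.algebraMap_end_apply] using this
    have hle := (LinearMap.finrank_eigenspace_le g z).trans hz.le
    obtain ⟨w, hw⟩ := finrank_le_one_iff.1 hle
    obtain ⟨a, ha⟩ := hw ⟨v, hv.1⟩
    obtain ⟨b, hb⟩ := hw ⟨_, hx⟩
    have ha0 : a ≠ 0 := by
      rintro rfl
      rw [zero_smul] at ha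
      exact hv.2 (congrArg Subtype.val ha).symm
    refine ⟨b * a⁻¹, ?_⟩
    have ha' := congrArg Subtype.val ha
    have hb' := congrArg Subtype.val hb
    simp only [SetLike.val_smul] at ha' hb'
    rw [← hb', ← ha', smul_smul, mul_assoc, inv_mul_cancel₀ ha0, mul_one]
  obtain ⟨l, hl⟩ : ∃ l : Module.Dual ℂ V, l v ≠ 0 := by
    by_contra! h
    exact hv.2 ((Module.forall_dual_apply_eq_zero_iff ℂ v).1 h)
  -- With this normalisation f(v) = q(z), nonzero because z is a simple root.
  refine ⟨q, (l v)⁻¹ • l ∘ₗ Polynomial.aeval g q, v, fun x => ?_, ?_⟩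
  · obtain ⟨c, hc⟩ := hrange x
    simp [hc, mul_left_comm, hl]
  · simpa [hev, hl] using hnd

theorem aeval_apply_mem {V : Type*} [AddCommGroup V] [Module ℂ V] {g : Module.End ℂ V}
    {W : Submodule ℂ V} (hW : ∀ x ∈ W, g x ∈ W) (q : Polynomial ℂ) {x : V} (hx : x ∈ W) :
    Polynomial.aeval g q x ∈ W := by
  induction q using Polynomial.induction_on' with
  | add p q hp hq => rw [map_add]; exact W.add_mem hp hq
  | monomial k a =>
    have hk : (g ^ k) x ∈ W := by
      induction k with
      | zero => exact hx
      | succ k ih => rw [pow_succ']; exact hW _ ih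
    rw [Polynomial.aeval_monomial]
    exact W.smul_mem a hk

/-- A polynomial in `g` has the form x ↦ f(x)v, so v lies in every `J`-invariant subspace on which f
does not vanish. Among the translates of a minimal invariant subspace, one, U, contains v. If f(δv)
≠ 0, then U and δU both contain v and coincide by minimality. This makes the stabilizer of U of
finite index, and strong irreducibility forces U to be everything. -/
theorem isIrreducibleRep_of_normal_of_isProximal {n : ℕ} {Δ : Subgroup (GL (Fin n) ℂ)}
    (hΔ : IsStronglyIrreducible Δ) {J : Subgroup Δ} (hJ : J.Normal) {g : Δ} (hgJ : g ∈ J)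
    (hg : IsProximal (g : GL (Fin n) ℂ)) : IsIrreducibleRep (Δ.subtype.comp J.subtype) := by
  obtain ⟨z, hz, -⟩ := hg
  let ρ := toRep Δ.subtype
  obtain ⟨q, f, v, hq, hfv⟩ := exists_aeval_eq_rank_one (ρ g) z (by
    have : (ρ g).charpoly = (g : GL (Fin n) ℂ).val.charpoly := Matrix.charpoly_toLin' _
    rw [this, hz])
  have hinv : ∀ δ x, ρ δ⁻¹ (ρ δ x) = x := fun δ x => by
    rw [← Module.End.mul_apply, ← map_mul, inv_mul_cancel, map_one, Module.End.one_apply]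
  let Inv (U : Submodule ℂ (Fin n → ℂ)) : Prop := ∀ j ∈ J, ∀ x ∈ U, ρ j x ∈ U
  have hInvMap : ∀ δ U, Inv U → Inv (U.map (ρ δ)) := by
    rintro δ U hU j hj _ ⟨x, hx, rfl⟩
    refine ⟨ρ (δ⁻¹ * j * δ) x, hU _ ?_ x hx, ?_⟩
    · simpa using hJ.conj_mem j hj δ⁻¹
    · simp only [← Module.End.mul_apply, ← map_mul]
      congr 2; group
  have hmapmap : ∀ δ ε (U : Submodule ℂ (Fin n → ℂ)),
      (U.map (ρ δ)).map (ρ ε) = U.map (ρ (ε * δ)) := fun δ ε U => by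
    rw [← Submodule.map_comp, map_mul]; rfl
  have hmapone : ∀ U : Submodule ℂ (Fin n → ℂ), U.map (ρ 1) = U := fun U => by
    rw [map_one]; exact Submodule.map_id U
  have hirr : ∀ S : Subgroup Δ, S.FiniteIndex → ∀ U : Submodule ℂ (Fin n → ℂ),
      (∀ s ∈ S, ∀ x ∈ U, ρ s x ∈ U) → U = ⊥ ∨ U = ⊤ := fun S hS U hU =>
    ((isIrreducibleRep_iff _).1 (hΔ S hS)).2 U fun s x hx => hU s s.2 x hx
  have hn : n ≠ 0 := ((isIrreducibleRep_iff _).1 (hΔ ⊤ inferInstance)).1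
  have hne : Nonempty (Fin n) := ⟨⟨0, Nat.pos_of_ne_zero hn⟩⟩
  -- a minimal `J`-invariant subspace
  obtain ⟨U₀, ⟨hU₀, hU₀i⟩, hmin⟩ := (wellFounded_lt (α := Submodule ℂ (Fin n → ℂ))).has_min
    {U | U ≠ ⊥ ∧ Inv U} ⟨⊤, top_ne_bot, fun _ _ _ _ => trivial⟩
  -- its translates span, so one of them is not killed by `f`
  obtain ⟨δ₀, x₀, hx₀, hfx₀⟩ : ∃ δ, ∃ x ∈ U₀, f (ρ δ x) ≠ 0 := by
    by_contra! hcon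
    have htop : (⨆ δ, U₀.map (ρ δ)) = ⊤ := by
      refine (hirr ⊤ inferInstance _ fun s _ x hx => ?_).resolve_left fun h => ?_
      · have : (⨆ δ, U₀.map (ρ δ)).map (ρ s) ≤ ⨆ δ, U₀.map (ρ δ) := by
          rw [Submodule.map_iSup]
          refine iSup_le fun δ => ?_
          rw [hmapmap]
          exact le_iSup (fun δ => U₀.map (ρ δ)) (s * δ)
        exact this ⟨x, hx, rfl⟩
      · have := le_iSup (fun δ => U₀.map (ρ δ)) 1
        rw [h, hmapone] at this
        exact hU₀ (le_bot_iff.1 this)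
    have hle : (⨆ δ, U₀.map (ρ δ)) ≤ LinearMap.ker f := by
      refine iSup_le fun δ => ?_
      rintro _ ⟨x, hx, rfl⟩
      exact hcon δ x hx
    rw [htop] at hle
    exact hfv (hle (Submodule.mem_top (x := v)))
  let U := U₀.map (ρ δ₀)
  have hUi : Inv U := hInvMap _ _ hU₀i
  have hmin' : ∀ δ (W : Submodule ℂ (Fin n → ℂ)), W ≠ ⊥ → Inv W → W ≤ U.map (ρ δ) →
      W = U.map (ρ δ) := by
    intro δ W hW hWi hWle
    have h1 : W.map (ρ (δ * δ₀)⁻¹) ≤ U₀ := by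
      refine (Submodule.map_mono hWle).trans ?_
      rw [hmapmap, hmapmap, mul_assoc, inv_mul_cancel, hmapone]
    have h2 : W.map (ρ (δ * δ₀)⁻¹) ≠ ⊥ := by
      intro h
      have := congrArg (Submodule.map (ρ (δ * δ₀))) h
      rw [hmapmap, mul_inv_cancel, hmapone, Submodule.map_bot] at this
      exact hW this
    have h3 := eq_of_le_of_not_lt h1 (hmin _ ⟨h2, hInvMap _ _ hWi⟩)
    have := congrArg (Submodule.map (ρ (δ * δ₀))) h3
    rwa [hmapmap, mul_inv_cancel, hmapone, ← hmapmap] at this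
  -- a `J`-invariant subspace on which `f` does not vanish contains `v`
  have hvmem : ∀ W, Inv W → ∀ x ∈ W, f x ≠ 0 → v ∈ W := by
    intro W hW x hx hfx
    have h1 : Polynomial.aeval (ρ g) q x ∈ W := aeval_apply_mem (hW g hgJ) q hx
    rw [hq] at h1
    exact (W.smul_mem_iff hfx).1 h1
  have hvU : v ∈ U := hvmem U hUi _ ⟨x₀, hx₀, rfl⟩ hfx₀
  have hv0 : v ≠ 0 := fun h => hfv (by rw [h, map_zero])
  have hUbot : U ≠ ⊥ := (Submodule.ne_bot_iff _).2 ⟨v, hvU, hv0⟩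
  -- the stabilizer of `U`
  let S : Subgroup Δ :=
    { carrier := {δ | U.map (ρ δ) = U}
      one_mem' := hmapone U
      mul_mem' := fun {a b} (ha : _ = _) (hb : _ = _) => by
        change U.map (ρ (a * b)) = U
        rw [← hmapmap, hb, ha]
      inv_mem' := fun {a} (ha : _ = _) => by
        change U.map (ρ a⁻¹) = U
        conv_lhs => rw [← ha]
        rw [hmapmap, inv_mul_cancel, hmapone] }
  have hS : ∀ δ, f (ρ δ v) ≠ 0 → δ ∈ S := by
    intro δ h
    have h1 : v ∈ U.map (ρ δ) := hvmem _ (hInvMap δ U hUi) _ ⟨v, hvU, rfl⟩ h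
    have h2 : U ⊓ U.map (ρ δ) ≠ ⊥ := (Submodule.ne_bot_iff _).2 ⟨v, ⟨hvU, h1⟩, hv0⟩
    have h3 : Inv (U ⊓ U.map (ρ δ)) := fun j hj x hx =>
      ⟨hUi j hj x hx.1, hInvMap δ U hUi j hj x hx.2⟩
    have h4 := hmin' δ _ h2 h3 inf_le_right
    have h5 := hmin' 1 _ h2 h3 (by rw [hmapone]; exact inf_le_left)
    rw [hmapone] at h5
    exact h4.symm.trans h5
  have hSfin : S.FiniteIndex := by
    -- Applying f ∘ y⁻¹ isolates the coefficient at y: if f(y⁻¹xv) ≠ 0 then y⁻¹x ∈ S. Hence there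
    -- are finitely many cosets.
    have hli : LinearIndependent ℂ fun x : Δ ⧸ S => ρ x.out v := by
      rw [linearIndependent_iff']
      intro s c hsum y hy
      have := congrArg (fun w => f (ρ y.out⁻¹ w)) hsum
      simp only [map_sum, map_smul, map_zero] at this
      rw [Finset.sum_eq_single_of_mem y hy, hinv, smul_eq_mul] at this
      · exact (mul_eq_zero.1 this).resolve_right hfv
      · intro x _ hxy
        by_contra hcon
        refine hxy ?_
        have hx := hS (y.out⁻¹ * x.out) fun h => hcon (by
          rw [map_mul, Module.End.mul_apply] at h
          rw [h, smul_zero])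
        rw [← x.out_eq', ← y.out_eq']
        exact (QuotientGroup.eq.2 hx).symm
    have := hli.finite
    exact Subgroup.finiteIndex_of_finite_quotient
  have hUtop : U = ⊤ := (hirr S hSfin U fun s hs x hx => by
    have : U.map (ρ s) = U := hs
    rw [← this]; exact ⟨x, hx, rfl⟩).resolve_left hUbot
  refine (isIrreducibleRep_iff _).2 ⟨hn, fun W hW => or_iff_not_imp_left.2 fun hW0 => ?_⟩
  have := hmin' 1 W hW0 (fun j hj x hx => hW ⟨j, hj⟩ x hx) (by rw [hmapone, hUtop]; exact le_top)
  rwa [hmapone, hUtop] at this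

/-! ### Residual p-finiteness of finitely generated linear groups -/

theorem isJacobsonRing_int : IsJacobsonRing ℤ := by
  rw [isJacobsonRing_iff_prime_eq]
  intro P hP
  by_cases h : P = ⊥
  · subst h
    refine le_antisymm (fun x hx => ?_) Ideal.le_jacobson
    -- For x in the radical, x² + 1 is a unit of ℤ, hence equal to 1.
    have h1 := Ideal.mem_jacobson_bot.1 hx x
    have h2 : x * x + 1 = 1 := by
      rcases Int.isUnit_iff.1 h1 with h | h
      · exact h
      · nlinarith [mul_self_nonneg x]
    simpa using h2
  · have := Ring.DimensionLEOne.maximalOfPrime h hP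
    exact Ideal.jacobson_eq_self_of_isMaximal

/-- By the Nullstellensatz over the Jacobson ring ℤ, `k` is a finite ℤ-module. Characteristic zero
would make ℤ a field by integrality. -/
theorem finite_of_field_of_finiteType_int (k : Type*) [Field k] [Algebra ℤ k]
    [Algebra.FiniteType ℤ k] :
    Finite k ∧ ∃ p : ℕ, p.Prime ∧ (p : k) = 0 := by
  obtain rfl : ‹Algebra ℤ k› = Ring.toIntAlgebra k := Subsingleton.elim _ _
  have := isJacobsonRing_int
  have hfin : Module.Finite ℤ k := finite_of_finite_type_of_isJacobsonRing ℤ k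
  have hp : ringChar k ≠ 0 := by
    intro h0
    have hc : CharZero k := by
      have := ringChar.charP k
      rw [h0] at this
      exact CharP.charP_to_charZero k
    have hinj : Function.Injective (algebraMap ℤ k) := (algebraMap ℤ k).injective_int
    exact Int.not_isField (isField_of_isIntegral_of_isField hinj (Field.toIsField k))
  have hz : ((ringChar k : ℕ) : k) = 0 := ringChar.Nat.cast_ringChar
  refine ⟨Module.finite_of_fg_torsion k fun {x} => ?_, ringChar k, ?_, hz⟩
  · refine ⟨⟨(ringChar k : ℤ), mem_nonZeroDivisors_of_ne_zero (by exact_mod_cast hp)⟩, ?_⟩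
    change (ringChar k : ℤ) • x = 0
    rw [zsmul_eq_mul, Int.cast_natCast, hz, zero_mul]
  · exact (CharP.char_is_prime_or_zero k (ringChar k)).resolve_right hp

/-- With Y = X^(p^k), the identity Yᵖ - 1 = (1 + Y + … + Yᵖ⁻¹)(Y - 1) gains one power of `I` at each
step: the sum is congruent to p, hence to 0, modulo `I`. -/
theorem pow_prime_pow_sub_one_mem {R : Type*} [CommRing R] {n : ℕ} (I : Ideal R) {p : ℕ}
    (hp : (p : R) ∈ I) (X : Matrix (Fin n) (Fin n) R) (hX : ∀ i j, (X - 1) i j ∈ I) (k : ℕ) :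
    ∀ i j, (X ^ p ^ k - 1) i j ∈ I ^ (k + 1) := by
  have hmul : ∀ (a b : ℕ) (A B : Matrix (Fin n) (Fin n) R), (∀ i j, A i j ∈ I ^ a) →
      (∀ i j, B i j ∈ I ^ b) → ∀ i j, (A * B) i j ∈ I ^ (a + b) := by
    intro a b A B hA hB i j
    rw [Matrix.mul_apply, pow_add]
    exact Ideal.sum_mem _ fun l _ => Ideal.mul_mem_mul (hA i l) (hB l j)
  have hpow : ∀ (Y : Matrix (Fin n) (Fin n) R), (∀ i j, (Y - 1) i j ∈ I) → ∀ (l : ℕ) i j,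
      (Y ^ l - 1) i j ∈ I := by
    intro Y hY l i j
    rw [← mul_geom_sum]
    have := hmul 1 0 (Y - 1) (∑ i ∈ Finset.range l, Y ^ i) (by simpa using hY) (by simp) i j
    simpa using this
  induction k with
  | zero => simpa using hX
  | succ k ih =>
    intro i j
    rw [pow_succ p, pow_mul, ← geom_sum_mul, add_comm (k + 1) 1]
    refine hmul 1 (k + 1) _ _ (fun i j => ?_) ih i j
    rw [pow_one]
    have h1 : (∑ i ∈ Finset.range p, (X ^ p ^ k) ^ i) =
        (∑ i ∈ Finset.range p, ((X ^ p ^ k) ^ i - 1)) + (p : Matrix (Fin n) (Fin n) R) := by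
      simp
    rw [h1, Matrix.add_apply, Matrix.sum_apply]
    refine I.add_mem (I.sum_mem fun l _ => ?_) ?_
    · rw [← pow_mul]
      exact hpow X hX _ i j
    · rw [Matrix.natCast_apply]
      split_ifs
      · exact hp
      · simp

/-- Finitely generated linear groups over `ℂ` are virtually residually `p`, for some prime `p`
not dividing a prescribed `b ≠ 0`. -/
theorem exists_residually_pgroup {n : ℕ} (Δ : Subgroup (GL (Fin n) ℂ)) (hΔ : Δ.FG) (b : ℕ)
    (hb : b ≠ 0) : ∃ p : ℕ, p.Prime ∧ ¬ p ∣ b ∧ ∃ Γ : Subgroup Δ, Γ.Normal ∧ Γ.FiniteIndex ∧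
      ∀ x : Δ, x ≠ 1 → ∃ N : Subgroup Δ, N.Normal ∧ N.FiniteIndex ∧ x ∉ N ∧
        ∀ g ∈ Γ, ∃ j, g ^ p ^ j ∈ N := by
  obtain ⟨S, hS⟩ := hΔ
  -- Adjoining b⁻¹ makes b a unit, so no residue characteristic of the resulting ring divides b.
  let E : Set ℂ := (Set.range fun t : S × Fin n × Fin n => t.1.1.val t.2.1 t.2.2) ∪
    (Set.range fun t : S × Fin n × Fin n => (t.1.1⁻¹).val t.2.1 t.2.2) ∪ {(b : ℂ)⁻¹}
  have hE : E.Finite := ((Set.finite_range _).union (Set.finite_range _)).union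
    (Set.finite_singleton _)
  let A : Subalgebra ℤ ℂ := Algebra.adjoin ℤ E
  have hAft : Algebra.FiniteType ℤ A :=
    (Subalgebra.fg_iff_finiteType A).1 ⟨hE.toFinset, by rw [hE.coe_toFinset]⟩
  have hAn : IsNoetherianRing A := Algebra.FiniteType.isNoetherianRing ℤ A
  let F : GL (Fin n) A →* GL (Fin n) ℂ := Matrix.GeneralLinearGroup.map A.val.toRingHom
  have hF : Function.Injective F := by
    intro x y hxy
    refine Units.ext (Matrix.ext fun i j => Subtype.ext ?_)
    exact congrFun (congrFun (congrArg (fun u : GL (Fin n) ℂ => u.val) hxy) i) j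
  have hle : Δ ≤ F.range := by
    rw [← hS, Subgroup.closure_le]
    intro s hs
    let B : Matrix (Fin n) (Fin n) A := fun i j =>
      ⟨s.val i j, Algebra.subset_adjoin (Or.inl (Or.inl ⟨(⟨s, hs⟩, i, j), rfl⟩))⟩
    let C : Matrix (Fin n) (Fin n) A := fun i j =>
      ⟨(s⁻¹).val i j, Algebra.subset_adjoin (Or.inl (Or.inr ⟨(⟨s, hs⟩, i, j), rfl⟩))⟩
    have hinj : Function.Injective (A.val.toRingHom.mapMatrix (m := Fin n)) := by
      intro x y hxy
      exact Matrix.ext fun i j => Subtype.ext (congrFun (congrFun hxy i) j)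
    have hB : A.val.toRingHom.mapMatrix B = s.val := rfl
    have hC : A.val.toRingHom.mapMatrix C = (s⁻¹).val := rfl
    refine ⟨⟨B, C, hinj ?_, hinj ?_⟩, Units.ext rfl⟩
    · rw [map_mul, hB, hC, map_one, Units.mul_inv]
    · rw [map_mul, hB, hC, map_one, Units.inv_mul]
  let θ : Δ →* GL (Fin n) A :=
    (MonoidHom.ofInjective hF).symm.toMonoidHom.comp (Subgroup.inclusion hle)
  have hθ : ∀ δ : Δ, F (θ δ) = δ := fun δ => by
    have := (MonoidHom.ofInjective hF).apply_symm_apply (Subgroup.inclusion hle δ)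
    exact congrArg Subtype.val this
  obtain ⟨I, hI⟩ := Ideal.exists_maximal A
  let _ : Field (A ⧸ I) := Ideal.Quotient.field I
  have hkft : Algebra.FiniteType ℤ (A ⧸ I) :=
    Algebra.FiniteType.of_surjective (Ideal.Quotient.mkₐ ℤ I) (Ideal.Quotient.mkₐ_surjective ℤ I)
  obtain ⟨hkfin, p, hp, hpz⟩ := finite_of_field_of_finiteType_int (A ⧸ I)
  have hpI : (p : A) ∈ I := by
    rw [← Ideal.Quotient.eq_zero_iff_mem, map_natCast, hpz]
  have hpb : ¬ p ∣ b := by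
    rintro ⟨c, hc⟩
    let b' : A := ⟨(b : ℂ)⁻¹, Algebra.subset_adjoin (Or.inr rfl)⟩
    have h1 : (b : A) * b' = 1 := Subtype.ext (by
      change (b : ℂ) * (b : ℂ)⁻¹ = 1
      exact mul_inv_cancel₀ (Nat.cast_ne_zero.2 hb))
    refine hI.ne_top (I.eq_top_iff_one.2 ?_)
    rw [← h1, hc, Nat.cast_mul]
    exact I.mul_mem_right _ (I.mul_mem_right _ hpI)
  -- The congruence subgroups modulo I^k; `N 1` is the required Γ.
  let N : ℕ → Subgroup Δ := fun k =>
    ((Matrix.GeneralLinearGroup.map (n := Fin n) (Ideal.Quotient.mk (I ^ k))).comp θ).ker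
  have hfin : ∀ k, (N k).FiniteIndex := fun k => by
    have : Finite (A ⧸ I ^ k) := Ideal.finite_quotient_pow (IsNoetherian.noetherian I) k
    have : Finite (GL (Fin n) (A ⧸ I ^ k)) :=
      Finite.of_injective _ (Units.val_injective (α := Matrix (Fin n) (Fin n) (A ⧸ I ^ k)))
    exact Subgroup.finiteIndex_ker _
  have hmem : ∀ k δ, δ ∈ N k ↔ ∀ i j, ((θ δ).val - 1) i j ∈ I ^ k := by
    intro k δ
    have h1 : ∀ i j, ((θ δ).val - 1) i j ∈ I ^ k ↔ Ideal.Quotient.mk (I ^ k) ((θ δ).val i j) =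
        (1 : Matrix (Fin n) (Fin n) (A ⧸ I ^ k)) i j := by
      intro i j
      rw [← Ideal.Quotient.eq_zero_iff_mem, Matrix.sub_apply, map_sub, sub_eq_zero,
        Matrix.one_apply, Matrix.one_apply, apply_ite (Ideal.Quotient.mk (I ^ k)), map_one,
        map_zero]
    simp only [h1]
    constructor
    · intro h i j
      exact congrFun (congrFun (congrArg (fun u : GL (Fin n) (A ⧸ I ^ k) => u.val) h) i) j
    · intro h
      exact Units.ext (Matrix.ext h)
  refine ⟨p, hp, hpb, N 1, MonoidHom.normal_ker _, hfin 1, fun x hx => ?_⟩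
  -- Krull's intersection theorem: the powers of `I` meet in zero.
  obtain ⟨k, hk⟩ : ∃ k, x ∉ N k := by
    by_contra! hcon
    refine hx (Subtype.ext ?_)
    rw [← hθ x]
    have : θ x = 1 := by
      refine Units.ext (sub_eq_zero.1 (Matrix.ext fun i j => ?_))
      have h1 : ((θ x).val - 1) i j ∈ ⨅ k, I ^ k :=
        (Submodule.mem_iInf _).2 fun k => (hmem k x).1 (hcon k) i j
      rw [Ideal.iInf_pow_eq_bot_of_isDomain I hI.ne_top] at h1
      exact h1
    rw [this, map_one]
    rfl
  refine ⟨N k, MonoidHom.normal_ker _, hfin k, hk, fun g hg => ⟨k, (hmem _ _).2 fun i j => ?_⟩⟩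
  have := pow_prime_pow_sub_one_mem I hpI (θ g).val (by simpa using (hmem 1 g).1 hg) k i j
  rw [map_pow]
  exact Ideal.pow_le_pow_right (Nat.le_succ k) this

/-- Write the order of g as pᵃr with p ∤ r. In each of the quotients, the image of g^(pᵃ) has order
dividing both r and a power of p, so it is trivial. -/
theorem exists_pow_prime_pow_eq_one {G : Type*} [Group G] {p : ℕ} (hp : p.Prime)
    {Γ : Subgroup G}
    (hΓ : ∀ x : G, x ≠ 1 → ∃ N : Subgroup G, N.Normal ∧ N.FiniteIndex ∧ x ∉ N ∧
      ∀ g ∈ Γ, ∃ j, g ^ p ^ j ∈ N) {g : G} (hg : g ∈ Γ) (hfin : IsOfFinOrder g) :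
    ∃ a, g ^ p ^ a = 1 := by
  obtain ⟨a, r, hr, hn⟩ := Nat.exists_eq_pow_mul_and_not_dvd hfin.orderOf_pos.ne' p hp.ne_one
  refine ⟨a, ?_⟩
  by_contra hne
  obtain ⟨N, hN, -, hgN, hpow⟩ := hΓ _ hne
  obtain ⟨j, hj⟩ := hpow _ (Γ.pow_mem hg (p ^ a))
  refine hgN ((QuotientGroup.eq_one_iff _).1 ?_)
  have h1 : ((g ^ p ^ a : G) : G ⧸ N) ^ p ^ j = 1 := (QuotientGroup.eq_one_iff _).2 hj
  have h2 : ((g ^ p ^ a : G) : G ⧸ N) ^ r = 1 := by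
    rw [← QuotientGroup.mk_pow, ← pow_mul, ← hn, pow_orderOf_eq_one, QuotientGroup.mk_one]
  have h3 := pow_gcd_eq_one.2 ⟨h1, h2⟩
  rwa [Nat.Coprime.pow_left j ((Nat.Prime.coprime_iff_not_dvd hp).2 hr), pow_one] at h3

/-- Infinite subgroups of finitely generated linear groups have elements of infinite order. -/
theorem exists_not_isOfFinOrder {n : ℕ} {Δ : Subgroup (GL (Fin n) ℂ)} (hΔ : Δ.FG)
    (J : Subgroup Δ) [Infinite J] : ∃ g ∈ J, ¬ IsOfFinOrder g := by
  obtain ⟨p, hp, -, Γ, -, hΓf, hΓ⟩ := exists_residually_pgroup Δ hΔ 1 one_ne_zero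
  -- A second prime l ≠ p: a torsion element of Γ ∩ Γ' has order both a power of p and a power of l,
  -- so Γ ∩ Γ' is torsion-free.
  obtain ⟨l, hl, hlp, Γ', -, hΓf', hΓ'⟩ := exists_residually_pgroup Δ hΔ p hp.ne_zero
  have hne : (Γ ⊓ Γ').subgroupOf J ≠ ⊥ := by
    intro h
    have h1 : ((Γ ⊓ Γ').subgroupOf J).FiniteIndex := inferInstance
    rw [h, Subgroup.finiteIndex_iff, Subgroup.index_bot] at h1
    exact h1 Nat.card_eq_zero_of_infinite
  obtain ⟨x, hx, hx1⟩ := (Subgroup.ne_bot_iff_exists_ne_one.1 hne).elim fun x hx =>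
    (⟨x.1, x.2, fun h => hx (Subtype.ext h)⟩ : ∃ x ∈ (Γ ⊓ Γ').subgroupOf J, x ≠ 1)
  refine ⟨x, x.2, fun hfin => hx1 (Subtype.ext ?_)⟩
  have hx' : (x : Δ) ∈ Γ ⊓ Γ' := hx
  obtain ⟨a, ha⟩ := exists_pow_prime_pow_eq_one hp hΓ hx'.1 hfin
  obtain ⟨b, hb⟩ := exists_pow_prime_pow_eq_one hl hΓ' hx'.2 hfin
  have hcop : Nat.Coprime (p ^ a) (l ^ b) :=
    Nat.Coprime.pow a b ((Nat.Prime.coprime_iff_not_dvd hl).2 hlp).symm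
  have := pow_gcd_eq_one.2 ⟨ha, hb⟩
  rwa [hcop, pow_one] at this

/-! ### Invariant characters from class-two quotients -/

/-- Otherwise the lower central series is constant from the derived subgroup on, and nilpotency
makes that subgroup trivial. -/
theorem exists_commutator_notMem_lowerCentralSeries_two {P : Type*} [Group P] [Group.IsNilpotent P]
    {a b : P} (hab : ⁅a, b⁆ ≠ 1) : ∃ x y : P, ⁅x, y⁆ ∉ (⊤ : Subgroup P).lowerCentralSeries 2 := by
  by_contra! hcon
  have hle : (⊤ : Subgroup P).lowerCentralSeries 1 ≤ (⊤ : Subgroup P).lowerCentralSeries 2 := by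
    rw [Subgroup.top_lowerCentralSeries_one, commutator_def, Subgroup.commutator_le]
    exact fun x _ y _ => hcon x y
  have hall : ∀ k, (⊤ : Subgroup P).lowerCentralSeries 1 ≤ (⊤ : Subgroup P).lowerCentralSeries (k + 1) := by
    intro k
    induction k with
    | zero => exact le_rfl
    | succ k ih => exact hle.trans (Subgroup.commutator_mono ih le_rfl)
  obtain ⟨k, hk⟩ := Subgroup.nilpotent_iff_lowerCentralSeries.1 ‹Group.IsNilpotent P›
  have h1 : ⁅a, b⁆ ∈ (⊤ : Subgroup P).lowerCentralSeries k :=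
    Subgroup.lowerCentralSeries_antitone _ (Nat.le_succ k) (hall k
      (Subgroup.commutator_mem_commutator trivial trivial))
  rw [hk] at h1
  exact hab h1

/-- A group with a nonabelian finite `p`-quotient has a finite-index subgroup `Z` containing all
commutators, with a conjugation-invariant character that is nontrivial on some commutator. -/
theorem exists_invariant_character {G : Type*} [Group G] {p : ℕ} (hp : p.Prime) (N : Subgroup G)
    [N.Normal] [N.FiniteIndex] (hN : ∀ g : G, ∃ j, g ^ p ^ j ∈ N) {a b : G} (hab : ⁅a, b⁆ ∉ N) :
    ∃ (Z : Subgroup G) (φ : Z →* ℂˣ), Z.FiniteIndex ∧ (∀ x y : G, ⁅x, y⁆ ∈ Z) ∧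
      (∀ (g : G) (z w : Z), (w : G) = g * z * g⁻¹ → φ w = φ z) ∧
      ∃ (x y : G) (z : Z), (z : G) = ⁅x, y⁆ ∧ φ z ≠ 1 := by
  have : Fact p.Prime := ⟨hp⟩
  have : Finite (G ⧸ N) := Subgroup.finite_quotient_of_finiteIndex
  have hP : IsPGroup p (G ⧸ N) := by
    intro x
    obtain ⟨g, rfl⟩ := QuotientGroup.mk_surjective x
    obtain ⟨j, hj⟩ := hN g
    exact ⟨j, (QuotientGroup.eq_one_iff _).2 hj⟩
  have := hP.isNilpotent
  have hab' : ⁅(a : G ⧸ N), (b : G ⧸ N)⁆ ≠ 1 := fun h => hab ((QuotientGroup.eq_one_iff _).1 h)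
  obtain ⟨x', y', hxy⟩ := exists_commutator_notMem_lowerCentralSeries_two hab'
  obtain ⟨x, rfl⟩ := QuotientGroup.mk_surjective x'
  obtain ⟨y, rfl⟩ := QuotientGroup.mk_surjective y'
  -- Indexing starts at 0, so this is [[P, P], P] for P = G/N: modulo `D` all commutators are
  -- central, while [x, y] survives.
  let D : Subgroup (G ⧸ N) := (⊤ : Subgroup (G ⧸ N)).lowerCentralSeries 2
  let π : G →* (G ⧸ N) ⧸ D := (QuotientGroup.mk' D).comp (QuotientGroup.mk' N)
  have hπ : Function.Surjective π :=
    (QuotientGroup.mk'_surjective D).comp (QuotientGroup.mk'_surjective N)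
  have hcen : ∀ x y : G, π ⁅x, y⁆ ∈ Subgroup.center ((G ⧸ N) ⧸ D) := by
    intro x y
    rw [Subgroup.mem_center_iff]
    intro q
    obtain ⟨g, rfl⟩ := hπ q
    rw [← commutatorElement_eq_one_iff_mul_comm, ← commutatorElement_inv, inv_eq_one,
      ← map_commutatorElement]
    refine (QuotientGroup.eq_one_iff _).2 ?_
    have h1 : ⁅(x : G ⧸ N), (y : G ⧸ N)⁆ ∈ (⊤ : Subgroup (G ⧸ N)).lowerCentralSeries 1 :=
      Subgroup.commutator_mem_commutator (Subgroup.mem_top _) (Subgroup.mem_top _)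
    exact Subgroup.commutator_mem_commutator h1 (Subgroup.mem_top (g : G ⧸ N))
  let Z := (Subgroup.center ((G ⧸ N) ⧸ D)).comap π
  have hne : (⟨π ⁅x, y⁆, hcen x y⟩ : Subgroup.center ((G ⧸ N) ⧸ D)) ≠ 1 := fun h =>
    hxy ((QuotientGroup.eq_one_iff _).1 (congrArg Subtype.val h))
  obtain ⟨φ, hφ⟩ := CommGroup.exists_apply_ne_one_of_hasEnoughRootsOfUnity
    (Subgroup.center ((G ⧸ N) ⧸ D)) ℂ hne
  let f : Z →* Subgroup.center ((G ⧸ N) ⧸ D) :=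
    (π.comp Z.subtype).codRestrict _ fun z => z.2
  have hNZ : N ≤ Z := fun g hg => by
    have h1 : π g = 1 := by
      change QuotientGroup.mk' D (QuotientGroup.mk' N g) = 1
      rw [QuotientGroup.mk'_apply N, (QuotientGroup.eq_one_iff g).2 hg, map_one]
    change π g ∈ Subgroup.center ((G ⧸ N) ⧸ D)
    rw [h1]
    exact Subgroup.one_mem _
  refine ⟨Z, φ.comp f, Subgroup.finiteIndex_of_le hNZ, hcen, fun g z w hw => ?_, x, y, ⟨_, hcen x y⟩, rfl, hφ⟩
  have : f w = f z := Subtype.ext (by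
    change π w = π z
    rw [hw, map_mul, map_mul, map_inv, (Subgroup.mem_center_iff.1 z.2 (π g)),
      mul_inv_cancel_right])
  rw [MonoidHom.comp_apply, this, MonoidHom.comp_apply]

theorem exists_commutator_ne_one {n : ℕ} (hn : 2 ≤ n) {G : Type*} [Group G]
    {ρ : G →* GL (Fin n) ℂ} (hρ : IsIrreducibleRep ρ) : ∃ a b : G, ⁅a, b⁆ ≠ 1 := by
  by_contra! h
  have : IsMulCommutative G := ⟨⟨fun a b => commutatorElement_eq_one_iff_mul_comm.1 (h a b)⟩⟩
  have : (toRep ρ).IsIrreducible := hρ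
  have := Representation.IsIrreducible.finrank_eq_one_of_isMulCommutative (toRep ρ)
  rw [Module.finrank_fin_fun] at this
  omega

/-! ### Twisted tensor products on the fibre product -/

section FibreProduct

variable {G : Type*} [Group G] {N : Subgroup G} (hN : N.Normal)

/-- The inclusion of `N × N` into the fibre product. -/
def prodToFibreProduct : N × N →* fibreProduct N hN :=
  (N.subtype.prodMap N.subtype).codRestrict _ fun x => N.mul_mem (N.inv_mem x.1.2) x.2.2

/-- The character `(g₁, g₂) ↦ φ (g₁⁻¹ g₂)` of the fibre product, for an invariant `φ`. -/
def fibreCharacter (φ : N →* ℂˣ)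
    (hφ : ∀ (g : G) (z w : N), (w : G) = g * z * g⁻¹ → φ w = φ z) : fibreProduct N hN →* ℂˣ :=
  MonoidHom.mk' (fun l => φ ⟨l.1.1⁻¹ * l.1.2, l.2⟩) fun a b => by
    rw [← hφ b.1.1⁻¹ ⟨a.1.1⁻¹ * a.1.2, a.2⟩
      ⟨b.1.1⁻¹ * (a.1.1⁻¹ * a.1.2) * b.1.1⁻¹⁻¹, hN.conj_mem _ a.2 _⟩ rfl, ← map_mul]
    congr 1
    apply Subtype.ext
    simp [mul_assoc]

variable {φ : N →* ℂˣ} (hφ : ∀ (g : G) (z w : N), (w : G) = g * z * g⁻¹ → φ w = φ z)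

theorem fibreCharacter_prodToFibreProduct (x : N × N) :
    fibreCharacter hN φ hφ (prodToFibreProduct hN x) = (φ x.1)⁻¹ * φ x.2 := by
  rw [← map_inv, ← map_mul]
  rfl

theorem exists_conj_prodToFibreProduct (g : G × G) (x : N × N) : ∃ y : N × N,
    (prodToFibreProduct hN y : G × G) = g * prodToFibreProduct hN x * g⁻¹ ∧
      fibreCharacter hN φ hφ (prodToFibreProduct hN y) =
        fibreCharacter hN φ hφ (prodToFibreProduct hN x) := by
  refine ⟨(⟨g.1 * x.1 * g.1⁻¹, hN.conj_mem _ x.1.2 _⟩, ⟨g.2 * x.2 * g.2⁻¹, hN.conj_mem _ x.2.2 _⟩),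
    rfl, ?_⟩
  rw [fibreCharacter_prodToFibreProduct, fibreCharacter_prodToFibreProduct,
    hφ g.1 x.1 ⟨_, hN.conj_mem _ x.1.2 _⟩ rfl,
    hφ g.2 x.2 ⟨_, hN.conj_mem _ x.2.2 _⟩ rfl]

/-- A character of `G × G` kills the commutator (1, [a, b]), whereas the fibre character takes the
value φ(z) ≠ 1 there. -/
theorem not_extends_fibreCharacter {a b : G} {z : N} (hz : (z : G) = ⁅a, b⁆) (hz1 : φ z ≠ 1)
    (c : G × G →* ℂˣ) : ¬ ∀ l : fibreProduct N hN, c l = fibreCharacter hN φ hφ l := by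
  intro h
  have h1 := h (prodToFibreProduct hN (1, z))
  rw [fibreCharacter_prodToFibreProduct, map_one, inv_one, one_mul] at h1
  refine hz1 (h1.symm.trans ?_)
  change c (1, (z : G)) = 1
  have : ((1, (z : G)) : G × G) = ⁅((1, a) : G × G), (1, b)⁆ := by
    rw [hz]
    ext <;> simp [commutatorElement_def]
  rw [this, map_commutatorElement, commutatorElement_eq_one_iff_mul_comm, mul_comm]

/-- Pairs as functions on `Fin 2`. -/
def pairHom (G : Type*) [Group G] : G × G →* (Fin 2 → G) :=
  MonoidHom.mk' (fun x => ![x.1, x.2]) fun x y => by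
    funext i
    fin_cases i <;> rfl

theorem pairHom_surjective (G : Type*) [Group G] : Function.Surjective (pairHom G) := fun x =>
  ⟨(x 0, x 1), by funext i; fin_cases i <;> rfl⟩

/-- The external tensor square of a representation. -/
noncomputable def tensorSq {d : ℕ} (ρ : G →* GL (Fin d) ℂ) : G × G →* GL (Fin (d ^ 2)) ℂ :=
  (tensorPow ρ 2).comp (pairHom G)

theorem Spans.tensorSq {d : ℕ} {ρ : G →* GL (Fin d) ℂ} (h : Spans (ρ.comp N.subtype)) :
    Spans ((NonExtension.tensorSq ρ).comp
      ((fibreProduct N hN).subtype.comp (prodToFibreProduct hN))) := by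
  have h1 := (h.tensorPow 2).comp (pairHom_surjective N)
  convert h1 using 1
  ext1 x
  change _ = NonExtension.tensorPow _ 2 _
  rw [tensorPow_comp]
  change NonExtension.tensorPow ρ 2 _ = _
  congr 1
  funext i
  fin_cases i <;> rfl

include hφ in
theorem exists_irreducible_not_extends
    {d : ℕ} (hd : d ≠ 0) {ρ : G →* GL (Fin d) ℂ} (hρ : Spans (ρ.comp N.subtype))
    {a b : G} {z : N} (hz : (z : G) = ⁅a, b⁆) (hz1 : φ z ≠ 1) :
    ∃ τ : fibreProduct N hN →* GL (Fin (d ^ 2)) ℂ,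
    IsIrreducibleRep τ ∧ ¬ Extends (fibreProduct N hN).subtype τ := by
  have hs := hρ.tensorSq hN
  have hd2 := pow_ne_zero 2 hd
  refine ⟨twist (fibreCharacter hN φ hφ) ((tensorSq ρ).comp (fibreProduct N hN).subtype),
    ((Spans.of_comp (ρ := (tensorSq ρ).comp (fibreProduct N hN).subtype) hs).twist
      _).isIrreducibleRep hd2, fun hext => ?_⟩
  obtain ⟨c, hc⟩ := exists_extension_of_extends_twist hd2 _ _ _ _ hs
    (exists_conj_prodToFibreProduct hN hφ) hext
  exact not_extends_fibreCharacter hN hφ hz hz1 c hc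

include hφ in
theorem exists_irreducible_prod_not_extends
    {d : ℕ} (hd : d ≠ 0) {ρ : G →* GL (Fin d) ℂ} (hρ : Spans (ρ.comp N.subtype))
    {a b : G} {z : N} (hz : (z : G) = ⁅a, b⁆) (hz1 : φ z ≠ 1)
    {D : Type*} [Group D] {m : ℕ} (hm : m ≠ 0)
    (τ : D →* GL (Fin m) ℂ) {M J : Subgroup D} (hJ : J.Normal) (hJM : J ≤ M)
    (hτ : Spans (τ.comp J.subtype)) :
    ∃ ψ : fibreProduct N hN × M →* GL (Fin (d ^ 2 * m)) ℂ,
      IsIrreducibleRep ψ ∧ ¬ Extends ((fibreProduct N hN).subtype.prodMap M.subtype) ψ := by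
  let ι := (fibreProduct N hN).subtype.prodMap M.subtype
  let j := (prodToFibreProduct hN).prodMap (Subgroup.inclusion hJM)
  let T := (kron (d ^ 2) m).comp ((tensorSq ρ).prodMap τ)
  let χ := (fibreCharacter hN φ hφ).comp (MonoidHom.fst (fibreProduct N hN) M)
  have hs : Spans (T.comp (ι.comp j)) := by
    have e : T.comp (ι.comp j) = (kron (d ^ 2) m).comp (((tensorSq ρ).comp
        ((fibreProduct N hN).subtype.comp (prodToFibreProduct hN))).prodMap (τ.comp J.subtype)) :=
      MonoidHom.ext fun _ => rfl
    rw [e]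
    exact (hρ.tensorSq hN).kron hτ
  have hne : d ^ 2 * m ≠ 0 := mul_ne_zero (pow_ne_zero 2 hd) hm
  refine ⟨twist χ (T.comp ι),
    ((Spans.of_comp (ρ := T.comp ι) hs).twist _).isIrreducibleRep hne, fun hext => ?_⟩
  obtain ⟨c, hc⟩ := exists_extension_of_extends_twist hne ι j T χ hs (fun g x => by
    obtain ⟨y, hy, hy'⟩ := exists_conj_prodToFibreProduct hN hφ g.1 x.1
    exact ⟨(y, ⟨g.2 * x.2 * g.2⁻¹, hJ.conj_mem _ x.2.2 _⟩), Prod.ext hy rfl, hy'⟩) hext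
  exact not_extends_fibreCharacter hN hφ hz hz1 (c.comp (MonoidHom.inl _ _)) fun l => hc (l, 1)

end FibreProduct

/-! ### Infinite normal subgroups and the final assembly -/

theorem spans_of_infinite_normal {n : ℕ} {Δ : Subgroup (GL (Fin n) ℂ)}
    (hΔirr : IsStronglyIrreducible Δ) (hΔfg : Δ.FG)
    (hΔprox : ∀ g ∈ Δ, ¬ IsOfFinOrder g → IsProximal g) {J : Subgroup Δ} (hJ : J.Normal)
    [Infinite J] : Spans (Δ.subtype.comp J.subtype) := by
  obtain ⟨g, hg, hgf⟩ := exists_not_isOfFinOrder hΔfg J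
  exact (isIrreducibleRep_of_normal_of_isProximal hΔirr hJ hg
    (hΔprox g g.2 fun h => hgf (Submonoid.isOfFinOrder_coe.1 h))).spans

theorem spans_tensorPow_pi {D : Type*} [Group D] {m : ℕ} {τ : D →* GL (Fin m) ℂ} {N : Subgroup D}
    (h : Spans (τ.comp N.subtype)) (q : ℕ) :
    Spans ((tensorPow τ q).comp (Subgroup.pi Set.univ fun _ : Fin q => N).subtype) := by
  let f : (Fin q → N) →* Subgroup.pi Set.univ fun _ : Fin q => N :=
    (MonoidHom.pi fun i => N.subtype.comp (Pi.evalMonoidHom _ i)).codRestrict _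
      fun x i _ => (x i).2
  refine Spans.of_comp (f := f) ?_
  have e : ((tensorPow τ q).comp (Subgroup.pi Set.univ fun _ : Fin q => N).subtype).comp f =
      tensorPow (τ.comp N.subtype) q :=
    MonoidHom.ext fun x => (tensorPow_comp τ N.subtype q x).symm
  rw [e]
  exact h.tensorPow q

end NonExtension

theorem mainTheorem4 (d : ℕ) (hd : 2 ≤ d) (Δ : Subgroup (GL (Fin d) ℂ))
    (hΔirr : NonExtension.IsStronglyIrreducible Δ) (hΔfg : Δ.FG)
    (hΔprox : ∀ g ∈ Δ, ¬ IsOfFinOrder g → NonExtension.IsProximal g)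
    (K : Subgroup Δ) (hKinf : Infinite K) (hKfg : K.FG) (hK : NonExtension.IsCoabelian K) :
    ∃ (Γ K' : Subgroup Δ) (hN : (K'.subgroupOf Γ).Normal) (L : Subgroup (Γ × Γ)),
      -- `Γ` is a finite-index normal subgroup of `Δ`
      Γ.Normal ∧ Γ.FiniteIndex ∧
      -- `K'` is a finite-index normal subgroup of `K`
      K' ≤ K ∧ (K'.subgroupOf K).Normal ∧ (K'.subgroupOf K).FiniteIndex ∧
      -- `K'` is a coabelian subgroup of `Γ`
      K' ≤ Γ ∧ NonExtension.IsCoabelian (K'.subgroupOf Γ) ∧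
      -- `L` is a finite-index subgroup of the fibre product
      L ≤ NonExtension.fibreProduct (K'.subgroupOf Γ) hN ∧
      (L.subgroupOf (NonExtension.fibreProduct (K'.subgroupOf Γ) hN)).FiniteIndex ∧
      -- (i)
      (∃ ρ : L →* GL (Fin (d ^ 2)) ℂ,
        NonExtension.IsIrreducibleRep ρ ∧ ¬ NonExtension.Extends L.subtype ρ) ∧
      -- (ii)
      (∀ (m q : ℕ) (Δ' : Subgroup (GL (Fin m) ℂ)),
        NonExtension.IsStronglyIrreducible Δ' → Δ'.FG →
        (∀ g ∈ Δ', ¬ IsOfFinOrder g → NonExtension.IsProximal g) →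
        ∀ (M : Subgroup (Fin q → Δ')) (N : Subgroup Δ'), N.Normal → Infinite N →
          Subgroup.pi Set.univ (fun _ : Fin q => N) ≤ M →
          ∃ ψ : L × M →* GL (Fin (d ^ 2 * m ^ q)) ℂ,
            NonExtension.IsIrreducibleRep ψ ∧
            ¬ NonExtension.Extends (L.subtype.prodMap M.subtype) ψ) := by
  obtain ⟨hKn, hKab⟩ := hK
  obtain ⟨p, hp, -, Γ, hΓn, hΓf, hΓ⟩ :=
    NonExtension.exists_residually_pgroup Δ hΔfg 1 one_ne_zero
  obtain ⟨a, b, hab⟩ := NonExtension.exists_commutator_ne_one hd (hΔirr Γ hΓf)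
  obtain ⟨P, hPn, hPf, habP, hPpow⟩ := hΓ _ fun h => hab (Subtype.ext h)
  obtain ⟨Z, φ, hZf, hZc, hφ, x, y, z, hz, hz1⟩ :=
    NonExtension.exists_invariant_character hp (P.subgroupOf Γ) (fun g => hPpow g g.2) habP
  have hZmap : (Z.map Γ.subtype).FiniteIndex := by
    rw [Subgroup.finiteIndex_iff, Subgroup.index_map_subtype]
    exact mul_ne_zero hZf.index_ne_zero hΓf.index_ne_zero
  -- `Z` need not be normal in Δ; its core is, and has finite index.
  let W : Subgroup Δ := (Z.map Γ.subtype).normalCore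
  have hWZ : ∀ g : Γ, (g : Δ) ∈ W → g ∈ Z := fun g hg => by
    obtain ⟨z, hz, hzg⟩ := Subgroup.normalCore_le _ hg
    rwa [← Subtype.ext hzg]
  have hWΓ : W ≤ Γ := fun g hg => by
    obtain ⟨z, -, hzg⟩ := Subgroup.normalCore_le _ hg
    rw [← hzg]; exact z.2
  have hWn : W.Normal := Subgroup.normalCore_normal _
  have hWf : W.FiniteIndex := inferInstance
  -- Commutators of Γ lie in `K` because Δ/K is abelian, and in the core because a Δ-conjugate of
  -- such a commutator is again one, hence in `Z`.
  have hcomm : ∀ x y : Γ, ((x * y * x⁻¹ * y⁻¹ : Γ) : Δ) ∈ K ⊓ W := by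
    refine fun x y => ⟨?_, fun g => ?_⟩
    · refine (QuotientGroup.eq_one_iff _).1 ?_
      change (x.1 : Δ ⧸ K) * (y.1 : Δ ⧸ K) * (x.1 : Δ ⧸ K)⁻¹ * (y.1 : Δ ⧸ K)⁻¹ = 1
      rw [hKab (x.1 : Δ ⧸ K), mul_inv_cancel_right, mul_inv_cancel]
    · refine ⟨_, hZc ⟨g * x * g⁻¹, hΓn.conj_mem _ x.2 g⟩ ⟨g * y * g⁻¹, hΓn.conj_mem _ y.2 g⟩, ?_⟩
      change g * x * g⁻¹ * (g * y * g⁻¹) * (g * x * g⁻¹)⁻¹ * (g * y * g⁻¹)⁻¹ =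
        g * ((x : Δ) * y * (x : Δ)⁻¹ * (y : Δ)⁻¹) * g⁻¹
      group
  have hK'n : (K ⊓ W).Normal := inferInstance
  have hK'Γ : K ⊓ W ≤ Γ := inf_le_right.trans hWΓ
  have hN : ((K ⊓ W).subgroupOf Γ).Normal := inferInstance
  have hK'Z : (K ⊓ W).subgroupOf Γ ≤ Z := fun g hg => hWZ g hg.2
  -- A positive power of an infinite-order element of `K` lies in `W`.
  have hK'inf : Infinite (K ⊓ W : Subgroup Δ) := by
    obtain ⟨g, hg, hgf⟩ := NonExtension.exists_not_isOfFinOrder hΔfg K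
    obtain ⟨k, hk0, -, hk⟩ := Subgroup.exists_pow_mem_of_index_ne_zero hWf.index_ne_zero g
    by_contra hfin
    rw [not_infinite_iff_finite] at hfin
    have h1 := isOfFinOrder_of_finite (⟨g ^ k, K.pow_mem hg k, hk⟩ : (K ⊓ W : Subgroup Δ))
    rw [← Submonoid.isOfFinOrder_coe, isOfFinOrder_pow] at h1
    exact h1.elim hgf hk0.ne'
  have hspan := NonExtension.spans_of_infinite_normal hΔirr hΔfg hΔprox hK'n
  have hρ : NonExtension.Spans ((Δ.subtype.comp Γ.subtype).comp
      ((K ⊓ W).subgroupOf Γ).subtype) :=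
    hspan.comp (f := (Subgroup.subgroupOfEquivOfLe hK'Γ).toMonoidHom) (MulEquiv.surjective _)
  let φ' : (K ⊓ W).subgroupOf Γ →* ℂˣ := φ.comp (Subgroup.inclusion hK'Z)
  have hφ' : ∀ (g : Γ) (z w : (K ⊓ W).subgroupOf Γ), (w : Γ) = g * z * g⁻¹ → φ' w = φ' z :=
    fun g z w h => hφ g _ _ h
  have hzK : (z : Γ) ∈ (K ⊓ W).subgroupOf Γ := by
    rw [hz]; exact hcomm x y
  have hz' : φ' ⟨z, hzK⟩ ≠ 1 := hz1
  have hd0 : d ≠ 0 := by omega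
  -- `L` is the whole fibre product.
  refine ⟨Γ, K ⊓ W, hN, NonExtension.fibreProduct _ hN, hΓn, hΓf, inf_le_left, inferInstance,
    ?_, hK'Γ, ⟨hN, ?_⟩, le_rfl, ?_,
    NonExtension.exists_irreducible_not_extends hN hφ' hd0 hρ hz hz', ?_⟩
  · rw [Subgroup.inf_subgroupOf_left]
    infer_instance
  · intro u v
    obtain ⟨u, rfl⟩ := QuotientGroup.mk_surjective u
    obtain ⟨v, rfl⟩ := QuotientGroup.mk_surjective v
    refine QuotientGroup.eq.2 ?_
    -- (uv)⁻¹(vu) is the commutator of v⁻¹ and u⁻¹.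
    have := hcomm v⁻¹ u⁻¹
    rw [Subgroup.mem_subgroupOf]
    simpa [mul_assoc] using this
  · rw [Subgroup.subgroupOf_self]
    infer_instance
  · intro m q Δ' hirr hfg hprox M N hNn hNinf hNM
    have hm : m ≠ 0 :=
      ((NonExtension.isIrreducibleRep_iff _).1 (hirr ⊤ inferInstance)).1
    have hs := NonExtension.spans_of_infinite_normal hirr hfg hprox hNn
    exact NonExtension.exists_irreducible_prod_not_extends hN hφ' hd0 hρ hz hz'
      (pow_ne_zero q hm) (NonExtension.tensorPow Δ'.subtype q)
      (J := Subgroup.pi Set.univ fun _ => N)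
      ⟨fun u hu g i hi => hNn.conj_mem _ (hu i hi) (g i)⟩ hNM
      (NonExtension.spans_tensorPow_pi hs q)
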